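/- Let $\mathcal{H}$ be a complex Hilbert space with inner product $\langle\cdot\mid\cdot\rangle$ (linear in the first variable), and let $A$ be a positive bounded linear operator on $\mathcal{H}$. Put $\langle x\mid y\rangle_A=\langle Ax\mid y\rangle$ and $\|x\|_A=\sqrt{\langle x\mid x\rangle_A}$ for $x,y\in\mathcal{H}$, and for a bounded linear operator $T$ on $\mathcal{H}$ put $$\|T\|_A=\sup\{\|Tx\|_A : x\in\mathcal{H},\ \|x\|_A=1\}\in[0,\infty]$$ (with $\sup\emptyset=0$). Let $\mathcal{B}_A(\mathcal{H})$ be the set of all bounded linear operators $T$ on $\mathcal{H}$ that admit an $A$-adjoint, i.e. a bounded linear operator $S$ on $\mathcal{H}$ with $\langle Tx\mid y\rangle_A=\langle x\mid Sy\rangle_A$ for all $x,y\in\mathcal{H}$; for $T\in\mathcal{B}_A(\mathcal{H})$ let $T^{\sharp}$ denote the unique $A$-adjoint of $T$ whose range is contained in the closure $\overline{\mathcal{R}(A)}$ of the range of $A$. Then for every $T\in\mathcal{B}_A(\mathcal{H})$ the quantities $\|T\|_A$ and $\|T^2\|_A$ are finite and $$2\|T^2\|_A\le\|T^{\sharp}T+TT^{\sharp}\|_A\le\|T^2\|_A+\|T\|_A^2.$$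 -/

import Mathlib

/-! Semi-Hilbertian spaces: a complex Hilbert space `H` with the semi-inner product
`⟨x | y⟩_A = ⟨A x | y⟩` induced by a positive bounded operator `A`. -/

namespace SemiHilbert

open scoped ENNReal

section

attribute [local instance 2000] InnerProductSpace.toInner

variable {H : Type*} [NormedAddCommGroup H] [InnerProductSpace ℂ H]

/-- The semi-inner product `⟨x | y⟩_A = ⟨A x | y⟩`, linear in `x` and conjugate-linear in `y`
(Mathlib's `inner ℂ` is conjugate-linear in its first argument). -/
noncomputable def aInner (A : H →L[ℂ] H) (x y : H) : ℂ := inner ℂ y (A x)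

/-- The seminorm `‖x‖_A = √⟨x | x⟩_A` of a vector. -/
noncomputable def aNorm (A : H →L[ℂ] H) (x : H) : ℝ := Real.sqrt (aInner A x x).re

/-- The operator seminorm `‖T‖_A = sup {‖T x‖_A : ‖x‖_A = 1}`, with values in `[0, ∞]`. -/
noncomputable def aOpNorm (A T : H →L[ℂ] H) : ℝ≥0∞ :=
  ⨆ (x : H) (_ : aNorm A x = 1), ENNReal.ofReal (aNorm A (T x))

/-- `S` is an `A`-adjoint of `T`: `⟨T x | y⟩_A = ⟨x | S y⟩_A` for all `x`, `y`. -/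
def IsAAdjoint (A T S : H →L[ℂ] H) : Prop :=
  ∀ x y : H, aInner A (T x) y = aInner A x (S y)

/-- The set `B_A(H)` of the bounded operators that admit an `A`-adjoint. -/
def BA (A : H →L[ℂ] H) : Set (H →L[ℂ] H) := {T | ∃ S, IsAAdjoint A T S}

/-- Among the `A`-adjoints of `T ∈ B_A(H)` exactly one has its range in the closure of the range
of `A`. -/
theorem existsUnique_aSharp [CompleteSpace H] {A : H →L[ℂ] H} (hA : A.IsPositive)
    {T : H →L[ℂ] H} (hT : T ∈ BA A) :
    ∃! S : H →L[ℂ] H, IsAAdjoint A T S ∧ Set.range S ⊆ closure (Set.range A) := by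
  have hsymm : ∀ x y : H, inner ℂ (A x) y = inner ℂ x (A y) := fun x y => hA.1 x y
  let K : Submodule ℂ H := (LinearMap.range (A : H →ₗ[ℂ] H)).topologicalClosure
  have hKc : IsClosed (K : Set H) := Submodule.isClosed_topologicalClosure _
  have : CompleteSpace K := hKc.completeSpace_coe
  have hKset : (K : Set H) = closure (Set.range A) := by
    rw [Submodule.topologicalClosure_coe]
    rfl
  have hker : ∀ z ∈ Kᗮ, A z = 0 := by
    intro z hz
    have hmem : A (A z) ∈ K := Submodule.le_topologicalClosure _ ⟨A z, rfl⟩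
    have h0 : inner ℂ (A (A z)) z = 0 := hz _ hmem
    rw [hsymm] at h0
    exact inner_self_eq_zero.mp h0
  have hkerK : ∀ z ∈ K, A z = 0 → z = 0 := by
    intro z hz hAz
    have hle : K ≤ (ℂ ∙ z)ᗮ := by
      refine Submodule.topologicalClosure_minimal _ ?_ (Submodule.isClosed_orthogonal _)
      rintro _ ⟨w, rfl⟩
      rw [Submodule.mem_orthogonal_singleton_iff_inner_left]
      change inner ℂ (A w) z = 0
      rw [hsymm, hAz, inner_zero_right]
    exact inner_self_eq_zero.mp (Submodule.mem_orthogonal_singleton_iff_inner_left.mp (hle hz))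
  obtain ⟨S, hS⟩ := hT
  refine ⟨K.starProjection ∘L S, ⟨?_, ?_⟩, ?_⟩
  · intro x y
    rw [hS x y]
    have h1 : A (S y - K.starProjection (S y)) = 0 :=
      hker _ (Submodule.sub_starProjection_mem_orthogonal _)
    rw [map_sub, sub_eq_zero] at h1
    simp only [aInner, ContinuousLinearMap.comp_apply, ← hsymm, h1]
  · rintro _ ⟨y, rfl⟩
    rw [← hKset]
    exact Submodule.starProjection_apply_mem _ _
  · rintro R ⟨hR, hRr⟩
    ext y
    have hRK : R y ∈ K := by
      have := hRr ⟨y, rfl⟩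
      rwa [← hKset] at this
    have hPK : K.starProjection (S y) ∈ K := Submodule.starProjection_apply_mem _ _
    refine sub_eq_zero.mp (hkerK _ (K.sub_mem hRK hPK) ?_)
    have h1 : A (S y - K.starProjection (S y)) = 0 :=
      hker _ (Submodule.sub_starProjection_mem_orthogonal _)
    rw [map_sub, sub_eq_zero] at h1
    rw [map_sub, sub_eq_zero]
    change A (R y) = A (K.starProjection (S y))
    rw [← h1]
    refine ext_inner_right ℂ fun x => ?_
    have h2 := (hR x y).symm.trans (hS x y)
    simpa only [aInner, ← hsymm] using h2

/-- The distinguished `A`-adjoint `T^♯` of `T ∈ B_A(H)`: the unique `A`-adjoint of `T` whose range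
lies in the closure of the range of `A`. -/
noncomputable def aSharp [CompleteSpace H] {A : H →L[ℂ] H} (hA : A.IsPositive)
    (T : H →L[ℂ] H) (hT : T ∈ BA A) : H →L[ℂ] H :=
  (existsUnique_aSharp hA hT).exists.choose

end

end SemiHilbert

namespace SemiHilbert

open scoped ENNReal InnerProductSpace

section

variable {H : Type*} [NormedAddCommGroup H] [InnerProductSpace ℂ H]

/-! With `R` the square root of `A`, `‖x‖_A = ‖R x‖`, so Hilbert space inequalities apply. Any
`A`-adjoint `S` of `T` serves; put `M = S T + T S`. Finiteness: iterated Cauchy–Schwarz bounds the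
`A`-symmetric `S T`, hence `T`. Upper bound: expand `‖M x‖_A²`; the cross term is `2 Re ⟨T x | T² S
x⟩_A`, and everything is controlled by `‖T x‖_A² + ‖S x‖_A² = ⟨M x | x⟩_A`. Lower bound: the row
`(u, v) ↦ T u + S v` composed with its adjoint is `M`, so its squared seminorm is at most `‖M‖_A`;
test it on multiples of `x` and `T² x`. -/

theorem IsAAdjoint.mul {A T S T' S' : H →L[ℂ] H} (h : IsAAdjoint A T S) (h' : IsAAdjoint A T' S') :
    IsAAdjoint A (T * T') (S' * S) := fun x y =>
  (h (T' x) y).trans (h' x (S y))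

theorem IsAAdjoint.add {A T S T' S' : H →L[ℂ] H} (h : IsAAdjoint A T S) (h' : IsAAdjoint A T' S') :
    IsAAdjoint A (T + T') (S + S') := fun x y => by
  have h1 := h x y
  have h2 := h' x y
  simp only [aInner, add_apply, map_add, inner_add_left, inner_add_right] at *
  rw [h1, h2]

theorem aNorm_eq_norm {A R : H →L[ℂ] H} (hR : ∀ x y : H, aInner A x y = ⟪R y, R x⟫_ℂ) (x : H) :
    aNorm A x = ‖R x‖ := by
  rw [aNorm, hR, norm_eq_sqrt_re_inner (𝕜 := ℂ)]
  rfl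

theorem aOpNorm_le {A T : H →L[ℂ] H} {c : ℝ} (h : ∀ x, aNorm A x = 1 → aNorm A (T x) ≤ c) :
    aOpNorm A T ≤ ENNReal.ofReal c :=
  iSup₂_le fun x hx => ENNReal.ofReal_le_ofReal (h x hx)

/-- Taking `2 ^ n`-th roots removes the constant `C` in the limit. -/
theorem le_of_forall_pow_two_pow_le {a b C : ℝ} (hb : 0 ≤ b)
    (h : ∀ n : ℕ, a ^ 2 ^ n ≤ C * b ^ 2 ^ n) : a ≤ b := by
  by_contra! hab
  have ha : 0 < a := hb.trans_lt hab
  have hlim : Filter.Tendsto (fun n : ℕ => C * (b / a) ^ 2 ^ n) Filter.atTop (nhds (C * 0)) :=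
    ((tendsto_pow_atTop_nhds_zero_of_lt_one (div_nonneg hb ha.le)
      ((div_lt_one ha).2 hab)).comp (tendsto_pow_atTop_atTop_of_one_lt one_lt_two)).const_mul C
  rw [mul_zero] at hlim
  have : (1 : ℝ) ≤ 0 := by
    refine ge_of_tendsto' hlim fun n => ?_
    rw [div_pow, ← mul_div_assoc, one_le_div (pow_pos ha _)]
    exact h n
  linarith

variable [CompleteSpace H]

/-! ### Reduction to the norm, and finiteness of the seminorms. -/

theorem exists_sqrt {A : H →L[ℂ] H} (hA : A.IsPositive) :
    ∃ R : H →L[ℂ] H, ∀ x y : H, aInner A x y = ⟪R y, R x⟫_ℂ := by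
  have hA0 : 0 ≤ A := (ContinuousLinearMap.nonneg_iff_isPositive A).2 hA
  refine ⟨CFC.sqrt A, fun x y => ?_⟩
  have hR : (CFC.sqrt A).IsPositive :=
    (ContinuousLinearMap.nonneg_iff_isPositive _).1 (CFC.sqrt_nonneg A)
  have hsymm : ⟪CFC.sqrt A y, CFC.sqrt A x⟫_ℂ = ⟪y, CFC.sqrt A (CFC.sqrt A x)⟫_ℂ :=
    hR.1 y (CFC.sqrt A x)
  rw [hsymm, ← mul_apply_eq_comp, CFC.sqrt_mul_sqrt_self A hA0]
  rfl

theorem IsAAdjoint.symm {A T S : H →L[ℂ] H} (hA : A.IsPositive) (h : IsAAdjoint A T S) :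
    IsAAdjoint A S T := by
  obtain ⟨R, hR⟩ := exists_sqrt hA
  intro x y
  have := congrArg (starRingEnd ℂ) (h y x)
  rw [hR, hR, inner_conj_symm, inner_conj_symm] at this
  rw [hR, hR, this]

/-- An operator that is its own `A`-adjoint is bounded for `‖·‖_A` by its norm. -/
theorem aNorm_apply_le_of_symmetric {A P : H →L[ℂ] H} (hA : A.IsPositive)
    (hP : IsAAdjoint A P P) {x : H} (hx : aNorm A x = 1) : aNorm A (P x) ≤ ‖P‖ := by
  obtain ⟨R, hR⟩ := exists_sqrt hA
  rw [aNorm_eq_norm hR] at hx ⊢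
  have hpow : ∀ k : ℕ, IsAAdjoint A (P ^ k) (P ^ k) := by
    intro k
    induction k with
    | zero => exact fun x y => rfl
    | succ k ih =>
      have := ih.mul hP
      rwa [← pow_succ, ← pow_succ'] at this
  -- Cauchy–Schwarz on `⟨P^k x | P^k x⟩_A = ⟨x | P^(2k) x⟩_A`, with `‖x‖_A = 1`.
  have hstep : ∀ k : ℕ, ‖R ((P ^ k) x)‖ ^ 2 ≤ ‖R ((P ^ (k + k)) x)‖ := by
    intro k
    have h1 := hpow k x ((P ^ k) x)
    rw [hR, hR, ← mul_apply_eq_comp (P ^ k) (P ^ k), ← pow_add,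
      inner_self_eq_norm_sq_to_K] at h1
    have h2 := norm_inner_le_norm (𝕜 := ℂ) (R ((P ^ (k + k)) x)) (R x)
    rw [← h1, hx, mul_one] at h2
    simpa using h2
  have hiter : ∀ n : ℕ, ‖R (P x)‖ ^ 2 ^ n ≤ ‖R ((P ^ 2 ^ n) x)‖ := by
    intro n
    induction n with
    | zero => simp
    | succ n ih =>
      calc ‖R (P x)‖ ^ 2 ^ (n + 1) = (‖R (P x)‖ ^ 2 ^ n) ^ 2 := by rw [← pow_mul, pow_succ]
        _ ≤ ‖R ((P ^ 2 ^ n) x)‖ ^ 2 := by gcongr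
        _ ≤ ‖R ((P ^ 2 ^ (n + 1)) x)‖ := by
          have := hstep (2 ^ n)
          rwa [← mul_two, ← pow_succ] at this
  refine le_of_forall_pow_two_pow_le (C := ‖R‖ * ‖x‖) (norm_nonneg _) fun n => (hiter n).trans ?_
  calc ‖R ((P ^ 2 ^ n) x)‖ ≤ ‖R‖ * (‖P ^ 2 ^ n‖ * ‖x‖) :=
        R.le_opNorm_of_le ((P ^ 2 ^ n).le_opNorm x)
    _ ≤ ‖R‖ * (‖P‖ ^ 2 ^ n * ‖x‖) := by
        gcongr
        exact norm_pow_le' _ (by positivity)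
    _ = ‖R‖ * ‖x‖ * ‖P‖ ^ 2 ^ n := by ring

theorem IsAAdjoint.sq_aNorm_le {A T S : H →L[ℂ] H} (hA : A.IsPositive) (h : IsAAdjoint A T S)
    (x : H) : aNorm A (T x) ^ 2 ≤ aNorm A ((S * T) x) * aNorm A x := by
  obtain ⟨R, hR⟩ := exists_sqrt hA
  simp only [aNorm_eq_norm hR]
  have h1 := h x (T x)
  rw [hR, hR, inner_self_eq_norm_sq_to_K] at h1
  have h2 := norm_inner_le_norm (𝕜 := ℂ) (R ((S * T) x)) (R x)
  rw [mul_apply_eq_comp, ← h1] at h2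
  simpa using h2

theorem IsAAdjoint.aOpNorm_lt_top {A T S : H →L[ℂ] H} (hA : A.IsPositive)
    (h : IsAAdjoint A T S) : aOpNorm A T < ⊤ := by
  refine (aOpNorm_le (c := Real.sqrt ‖S * T‖) fun x hx => ?_).trans_lt ENNReal.ofReal_lt_top
  refine Real.le_sqrt_of_sq_le ((h.sq_aNorm_le hA x).trans ?_)
  rw [hx, mul_one]
  exact aNorm_apply_le_of_symmetric hA ((h.symm hA).mul h) hx

theorem IsAAdjoint.aNorm_le {A T S : H →L[ℂ] H} (hA : A.IsPositive)
    (h : IsAAdjoint A T S) (x : H) : aNorm A (T x) ≤ (aOpNorm A T).toReal * aNorm A x := by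
  obtain ⟨R, hR⟩ := exists_sqrt hA
  have hx0 : 0 ≤ aNorm A x := Real.sqrt_nonneg _
  rcases hx0.eq_or_lt with hx | hx
  -- The supremum says nothing about `A`-null vectors, but `T` maps them to `A`-null vectors.
  · have := h.sq_aNorm_le hA x
    rw [← hx, mul_zero] at this
    rw [← hx, mul_zero]
    exact (pow_eq_zero_iff two_ne_zero).1 (le_antisymm this (sq_nonneg _)) |>.le
  · set r := aNorm A x with hr
    have hscale : ∀ z, aNorm A (((r⁻¹ : ℝ) : ℂ) • z) = r⁻¹ * aNorm A z := by
      intro z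
      rw [aNorm_eq_norm hR, aNorm_eq_norm hR, map_smul, norm_smul, Complex.norm_real,
        Real.norm_of_nonneg (inv_nonneg.2 hx0)]
    have h1 : aNorm A (((r⁻¹ : ℝ) : ℂ) • x) = 1 := by
      rw [hscale, ← hr, inv_mul_cancel₀ hx.ne']
    have h2 : ENNReal.ofReal (aNorm A (T (((r⁻¹ : ℝ) : ℂ) • x))) ≤ aOpNorm A T :=
      le_iSup₂ (f := fun y (_ : aNorm A y = 1) => ENNReal.ofReal (aNorm A (T y))) _ h1
    rw [ENNReal.ofReal_le_iff_le_toReal (h.aOpNorm_lt_top hA).ne, map_smul, hscale,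
      inv_mul_le_iff₀ hx] at h2
    linarith

/-! ### The two inequalities for `S T + T S`. -/

theorem IsAAdjoint.sq_aNorm_add_sq_aNorm {A T S : H →L[ℂ] H} (hA : A.IsPositive)
    (h : IsAAdjoint A T S) (x : H) :
    aNorm A (T x) ^ 2 + aNorm A (S x) ^ 2 ≤ aNorm A ((S * T + T * S) x) * aNorm A x := by
  obtain ⟨R, hR⟩ := exists_sqrt hA
  have h1 := h.symm hA (T x) x
  have h2 := h (S x) x
  rw [hR, hR, inner_self_eq_norm_sq_to_K] at h1 h2
  have h3 := norm_inner_le_norm (𝕜 := ℂ) (R x) (R ((S * T + T * S) x))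
  simp only [add_apply, mul_apply_eq_comp, map_add, inner_add_right,
    h1, h2] at h3
  simp only [aNorm_eq_norm hR, add_apply, mul_apply_eq_comp, map_add]
  refine le_trans (le_of_eq ?_) (h3.trans_eq (mul_comm _ _))
  norm_cast
  exact (abs_of_nonneg (by positivity)).symm

/-- A bound for `T^♯` follows from one for `T`. -/
theorem IsAAdjoint.aNorm_adjoint_le {A T S : H →L[ℂ] H} (hA : A.IsPositive)
    (h : IsAAdjoint A T S) (x : H) : aNorm A (S x) ≤ (aOpNorm A T).toReal * aNorm A x := by
  have h1 := (h.symm hA).sq_aNorm_le hA x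
  have h2 := h.aNorm_le hA (S x)
  have h0 : 0 ≤ aNorm A (S x) := Real.sqrt_nonneg _
  have hx : 0 ≤ aNorm A x := Real.sqrt_nonneg _
  rcases h0.eq_or_lt with h3 | h3
  · rw [← h3]
    positivity
  · rw [mul_apply_eq_comp] at h1
    nlinarith [mul_le_mul_of_nonneg_right h2 hx]

theorem IsAAdjoint.aOpNorm_anticommutator_le {A T S : H →L[ℂ] H} (hA : A.IsPositive)
    (h : IsAAdjoint A T S) :
    aOpNorm A (S * T + T * S) ≤ aOpNorm A (T ^ 2) + aOpNorm A T ^ 2 := by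
  have hsq : IsAAdjoint A (T ^ 2) (S ^ 2) := by
    rw [pow_two, pow_two]
    exact h.mul h
  set a := (aOpNorm A T).toReal with ha
  set b := (aOpNorm A (T ^ 2)).toReal with hb
  have ha0 : 0 ≤ a := ENNReal.toReal_nonneg
  have hb0 : 0 ≤ b := ENNReal.toReal_nonneg
  have hbound : aOpNorm A (S * T + T * S) ≤ ENNReal.ofReal (b + a ^ 2) := by
    refine aOpNorm_le fun x hx => ?_
    have hM := h.sq_aNorm_add_sq_aNorm hA x
    rw [hx, mul_one] at hM
    have hu := h.aNorm_adjoint_le hA (T x)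
    have hv := h.aNorm_le hA (S x)
    have hw := hsq.aNorm_le hA (S x)
    obtain ⟨R, hR⟩ := exists_sqrt hA
    have hc : RCLike.re ⟪R (S (T x)), R (T (S x))⟫_ℂ ≤ ‖R (T x)‖ * ‖R ((T ^ 2) (S x))‖ := by
      have h1 := h (T (S x)) (T x)
      rw [hR, hR] at h1
      rw [← h1]
      exact re_inner_le_norm _ _
    have hexp := norm_add_sq (𝕜 := ℂ) (R (S (T x))) (R (T (S x)))
    simp only [aNorm_eq_norm hR, add_apply, mul_apply_eq_comp, map_add, ← ha,
      ← hb] at *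
    generalize ‖R (S (T x)) + R (T (S x))‖ = m at *
    generalize RCLike.re ⟪R (S (T x)), R (T (S x))⟫_ℂ = q at *
    have hc' : q ≤ ‖R (T x)‖ * (b * ‖R (S x)‖) := hc.trans (by gcongr)
    have hu2 := pow_le_pow_left₀ (norm_nonneg _) hu 2
    have hv2 := pow_le_pow_left₀ (norm_nonneg _) hv 2
    -- The `a ^ 2` comes from the two squares, the `b` from the cross term via `2 ‖T x‖_A ‖S x‖_A ≤
    -- ‖T x‖_A² + ‖S x‖_A²`.
    have hmm : m ^ 2 ≤ (b + a ^ 2) * m :=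
      calc m ^ 2 ≤ (b + a ^ 2) * (‖R (T x)‖ ^ 2 + ‖R (S x)‖ ^ 2) := by
            nlinarith [mul_nonneg hb0 (sq_nonneg (‖R (T x)‖ - ‖R (S x)‖))]
        _ ≤ (b + a ^ 2) * m := by gcongr
    by_contra! hlt
    have : 0 ≤ b + a ^ 2 := by positivity
    nlinarith
  refine hbound.trans_eq ?_
  rw [ENNReal.ofReal_add hb0 (by positivity), ENNReal.ofReal_pow ha0, ha, hb,
    ENNReal.ofReal_toReal (h.aOpNorm_lt_top hA).ne,
    ENNReal.ofReal_toReal (hsq.aOpNorm_lt_top hA).ne]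

theorem IsAAdjoint.two_mul_aOpNorm_sq_le {A T S : H →L[ℂ] H} (hA : A.IsPositive)
    (h : IsAAdjoint A T S) :
    2 * aOpNorm A (T ^ 2) ≤ aOpNorm A (S * T + T * S) := by
  have hMadj : IsAAdjoint A (S * T + T * S) (S * T + T * S) :=
    ((h.symm hA).mul h).add (h.mul (h.symm hA))
  set m := (aOpNorm A (S * T + T * S)).toReal with hm
  have hm0 : 0 ≤ m := ENNReal.toReal_nonneg
  obtain ⟨R, hR⟩ := exists_sqrt hA
  have hw : ∀ w, ‖R (T w)‖ ^ 2 + ‖R (S w)‖ ^ 2 ≤ m * ‖R w‖ ^ 2 := by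
    intro w
    have h1 := h.sq_aNorm_add_sq_aNorm hA w
    have h2 := hMadj.aNorm_le hA w
    simp only [aNorm_eq_norm hR] at h1 h2
    nlinarith [norm_nonneg (R w)]
  -- By duality, the row inherits the bound `hw` on its adjoint `w ↦ (S w, T w)`.
  have hrow : ∀ u v, ‖R (T u) + R (S v)‖ ^ 2 ≤ m * (‖R u‖ ^ 2 + ‖R v‖ ^ 2) := by
    intro u v
    set w := T u + S v with hwdef
    have hRw : R (T u) + R (S v) = R w := (map_add R _ _).symm
    have h1 := h u w
    have h2 := h.symm hA v w
    rw [hR, hR] at h1 h2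
    have h3 : ‖R w‖ ^ 2 ≤ ‖R (S w)‖ * ‖R u‖ + ‖R (T w)‖ * ‖R v‖ := by
      rw [← inner_self_eq_norm_sq (𝕜 := ℂ) (R w)]
      nth_rewrite 2 [← hRw]
      rw [inner_add_right, h1, h2, map_add]
      exact add_le_add (re_inner_le_norm _ _) (re_inner_le_norm _ _)
    rw [hRw]
    have h4 : (‖R w‖ ^ 2) ^ 2 ≤ (m * ‖R w‖ ^ 2) * (‖R u‖ ^ 2 + ‖R v‖ ^ 2) :=
      calc (‖R w‖ ^ 2) ^ 2 ≤ (‖R (S w)‖ * ‖R u‖ + ‖R (T w)‖ * ‖R v‖) ^ 2 := by gcongr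
        _ ≤ (‖R (T w)‖ ^ 2 + ‖R (S w)‖ ^ 2) * (‖R u‖ ^ 2 + ‖R v‖ ^ 2) := by
          nlinarith [sq_nonneg (‖R (S w)‖ * ‖R v‖ - ‖R (T w)‖ * ‖R u‖)]
        _ ≤ _ := by
          gcongr
          exact hw w
    rcases (sq_nonneg ‖R w‖).eq_or_lt with h0 | h0
    · rw [← h0]
      positivity
    · exact le_of_mul_le_mul_left (by linarith) h0
  have hbound : aOpNorm A (T ^ 2) ≤ ENNReal.ofReal (m / 2) := by
    refine aOpNorm_le fun x hx => ?_
    rw [aNorm_eq_norm hR] at hx ⊢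
    set z := (T ^ 2) x with hz
    set t := ‖R z‖ with ht
    have ht0 : 0 ≤ t := norm_nonneg _
    -- The factor `t` gives `t • x` and `z` equal seminorms. Then `4 Re ⟨p, q⟩ ≤ ‖p + q‖²` and
    -- `hrow` yield `4 t³ ≤ 2 m t²`.
    have hinner : ⟪R (T ((t : ℂ) • x)), R (S z)⟫_ℂ = ((t ^ 3 : ℝ) : ℂ) := by
      have h1 := h.symm hA z (T ((t : ℂ) • x))
      rw [hR, hR] at h1
      have h2 : T (T ((t : ℂ) • x)) = (t : ℂ) • z := by
        rw [map_smul, map_smul]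
        rfl
      rw [h1, h2, map_smul, inner_smul_left, inner_self_eq_norm_sq_to_K, ← ht,
        Complex.conj_ofReal]
      push_cast
      change (t : ℂ) * (t : ℂ) ^ 2 = (t : ℂ) ^ 3
      ring
    have h3 := hrow ((t : ℂ) • x) z
    have hp := norm_add_sq (𝕜 := ℂ) (R (T ((t : ℂ) • x))) (R (S z))
    have hq := norm_sub_sq (𝕜 := ℂ) (R (T ((t : ℂ) • x))) (R (S z))
    rw [hinner] at hp hq
    have hre : RCLike.re (((t ^ 3 : ℝ) : ℂ)) = t ^ 3 := Complex.ofReal_re _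
    rw [hre] at hp hq
    have hRx : ‖R ((t : ℂ) • x)‖ = t := by
      rw [map_smul, norm_smul, hx, Complex.norm_real, Real.norm_of_nonneg ht0, mul_one]
    rw [hRx, ← ht] at h3
    have h4 : t ^ 2 * t ≤ t ^ 2 * (m / 2) := by
      nlinarith [sq_nonneg ‖R (T ((t : ℂ) • x)) - R (S z)‖]
    rcases ht0.eq_or_lt with h0 | h0
    · rw [← h0]
      positivity
    · exact le_of_mul_le_mul_left h4 (by positivity)
  calc 2 * aOpNorm A (T ^ 2) ≤ 2 * ENNReal.ofReal (m / 2) := by gcongr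
    _ = ENNReal.ofReal m := by
      rw [← ENNReal.ofReal_ofNat, ← ENNReal.ofReal_mul zero_le_two, mul_div_cancel₀ m two_ne_zero]
    _ = _ := ENNReal.ofReal_toReal (hMadj.aOpNorm_lt_top hA).ne

theorem isAAdjoint_aSharp {A : H →L[ℂ] H} (hA : A.IsPositive) (T : H →L[ℂ] H) (hT : T ∈ BA A) :
    IsAAdjoint A T (aSharp hA T hT) :=
  (existsUnique_aSharp hA hT).exists.choose_spec.1

end

end SemiHilbert

theorem mainTheorem5 {H : Type*} [NormedAddCommGroup H] [InnerProductSpace ℂ H] [CompleteSpace H]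
    (A : H →L[ℂ] H) (hA : A.IsPositive) (T : H →L[ℂ] H) (hT : T ∈ SemiHilbert.BA A) :
    SemiHilbert.aOpNorm A T < ⊤ ∧
    SemiHilbert.aOpNorm A (T ^ 2) < ⊤ ∧
    2 * SemiHilbert.aOpNorm A (T ^ 2) ≤
      SemiHilbert.aOpNorm A (SemiHilbert.aSharp hA T hT * T + T * SemiHilbert.aSharp hA T hT) ∧
    SemiHilbert.aOpNorm A (SemiHilbert.aSharp hA T hT * T + T * SemiHilbert.aSharp hA T hT) ≤
      SemiHilbert.aOpNorm A (T ^ 2) + SemiHilbert.aOpNorm A T ^ 2 := by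
  have h := SemiHilbert.isAAdjoint_aSharp hA T hT
  refine ⟨h.aOpNorm_lt_top hA, ?_, h.two_mul_aOpNorm_sq_le hA, h.aOpNorm_anticommutator_le hA⟩
  rw [pow_two]
  exact (h.mul h).aOpNorm_lt_top hA
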